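/- Let $R$ be a ring with unit, let $E$ and $E'$ be real topological vector spaces, let $C_1,\dots,C_n$ be convex subsets of $E$ and $C'_1,\dots,C'_n$ convex subsets of $E'$, and put $C=C_1\cup\dots\cup C_n$ and $C'=C'_1\cup\dots\cup C'_n$, with the subspace topologies. Suppose that every $C_i$ is closed in $C$, that every $C'_i$ is closed in $C'$, and that the topological spaces $C$ and $C'$ are normal (disjoint closed sets have disjoint neighbourhoods). Suppose also that the nerves of the two families are naturally isomorphic, in the sense that for every nonempty $s\subset\{1,\dots,n\}$ the intersection $\bigcap_{i\in s}C_i$ is nonempty if and only if $\bigcap_{i\in s}C'_i$ is nonempty. Let $q:C\to C'$ be a continuous map with $q(C_i)\subset C'_i$ for every $i$. Then the induced homomorphism of graded $R$-modules $q^*:\check H^*(C',R)\to\check H^*(C,R)$ on Alexander–Spanier cohomology with coefficients in $R$ is an isomorphism, that is, $q^*:\check H^p(C',R)\to\check H^p(C,R)$ is an isomorphism for every $p\ge 0$. -/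

import Mathlib

open Topology

/-! Alexander–Spanier cohomology of topological spaces, with coefficients in a unital ring `R`
(not assumed commutative; modules are left modules). -/

namespace AlexanderSpanier

/-- The `R`-module of all functions `X ^ (p + 1) → R`. -/
abbrev Fun (R : Type*) (X : Type*) (p : ℕ) : Type _ := (Fin (p + 1) → X) → R

/-- The coboundary
`(δ φ)(x₀, …, x_{p+1}) = ∑ i, (-1) ^ i φ(x₀, …, x_{i-1}, x_{i+1}, …, x_{p+1})`. -/
def funD (R : Type*) [Ring R] (X : Type*) (p : ℕ) : Fun R X p →ₗ[R] Fun R X (p + 1) where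
  toFun φ := fun x => ∑ i : Fin (p + 2), (-1 : ℤ) ^ (i : ℕ) • φ (fun j => x (i.succAbove j))
  map_add' φ ψ := by
    funext x
    simp [Finset.sum_add_distrib]
  map_smul' r φ := by
    funext x
    simp only [Pi.smul_apply, RingHom.id_apply, Finset.smul_sum]
    exact Finset.sum_congr rfl fun i _ => smul_comm _ _ _

theorem funD_funD (R : Type*) [Ring R] (X : Type*) (p : ℕ) (φ : Fun R X p) :
    funD R X (p + 1) (funD R X p φ) = 0 := by
  funext x
  simp only [funD, LinearMap.coe_mk, AddHom.coe_mk, Pi.zero_apply, Finset.smul_sum, smul_smul,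
    ← pow_add]
  rw [← Finset.sum_product']
  refine Finset.sum_involution
    (fun ij _ => (ij.1.succAbove ij.2, ij.2.predAbove ij.1)) ?_ ?_ ?_ ?_
  · rintro ⟨i, j⟩ -
    have h1 : (fun k => x ((i.succAbove j).succAbove ((j.predAbove i).succAbove k))) =
        fun k => x (i.succAbove (j.succAbove k)) := by
      funext k
      rw [Fin.succAbove_succAbove_succAbove_predAbove]
    have h2 : ((-1 : ℤ) ^ ((i.succAbove j : ℕ) + (j.predAbove i : ℕ))) =
        - (-1 : ℤ) ^ ((i : ℕ) + (j : ℕ)) := by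
      rw [Fin.neg_one_pow_succAbove_add_predAbove]
    simp only [h1, h2]
    simp
  · rintro ⟨i, j⟩ - - h
    exact Fin.succAbove_ne i j (congrArg Prod.fst h)
  · intros
    simp
  · rintro ⟨i, j⟩ -
    simp [Fin.succAbove_succAbove_predAbove, Fin.predAbove_predAbove_succAbove]

/-- The functions which are locally zero: every point of `X` has a neighbourhood `U` such that
`φ` vanishes on `U ^ (p + 1)`. Equivalently, there is an open cover of `X` such that `φ` vanishes
on all the tuples contained in a member of the cover. -/
def locallyZero (R : Type*) [Ring R] (X : Type*) [TopologicalSpace X] (p : ℕ) :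
    Submodule R (Fun R X p) where
  carrier := {φ | ∀ a : X, ∃ U ∈ 𝓝 a, ∀ x : Fin (p + 1) → X, (∀ i, x i ∈ U) → φ x = 0}
  zero_mem' := fun _ => ⟨Set.univ, Filter.univ_mem, fun _ _ => rfl⟩
  add_mem' := by
    intro φ ψ hφ hψ a
    obtain ⟨U, hU, hU0⟩ := hφ a
    obtain ⟨V, hV, hV0⟩ := hψ a
    refine ⟨U ∩ V, Filter.inter_mem hU hV, fun x hx => ?_⟩
    simp [hU0 x fun i => (hx i).1, hV0 x fun i => (hx i).2]
  smul_mem' := by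
    intro r φ hφ a
    obtain ⟨U, hU, hU0⟩ := hφ a
    exact ⟨U, hU, fun x hx => by simp [hU0 x hx]⟩

/-- The module of Alexander–Spanier `p`-cochains. -/
abbrev Cochain (R : Type*) [Ring R] (X : Type*) [TopologicalSpace X] (p : ℕ) : Type _ :=
  Fun R X p ⧸ locallyZero R X p

theorem locallyZero_le_comap_funD (R : Type*) [Ring R] (X : Type*) [TopologicalSpace X] (p : ℕ) :
    locallyZero R X p ≤ (locallyZero R X (p + 1)).comap (funD R X p) := by
  intro φ hφ a
  obtain ⟨U, hU, hU0⟩ := hφ a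
  refine ⟨U, hU, fun x hx => ?_⟩
  change ∑ i : Fin (p + 2), (-1 : ℤ) ^ (i : ℕ) • φ (fun j => x (i.succAbove j)) = 0
  exact Finset.sum_eq_zero fun i _ => by rw [hU0 _ fun j => hx _, smul_zero]

/-- The coboundary on Alexander–Spanier cochains. -/
def d (R : Type*) [Ring R] (X : Type*) [TopologicalSpace X] (p : ℕ) :
    Cochain R X p →ₗ[R] Cochain R X (p + 1) :=
  (locallyZero R X p).mapQ (locallyZero R X (p + 1)) (funD R X p)
    (locallyZero_le_comap_funD R X p)

theorem d_d (R : Type*) [Ring R] (X : Type*) [TopologicalSpace X] (p : ℕ) (c : Cochain R X p) :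
    d R X (p + 1) (d R X p c) = 0 := by
  obtain ⟨φ, rfl⟩ := Submodule.mkQ_surjective _ c
  simp [d, funD_funD]

/-- The cocycles of degree `p`. -/
def cocycles (R : Type*) [Ring R] (X : Type*) [TopologicalSpace X] (p : ℕ) :
    Submodule R (Cochain R X p) :=
  LinearMap.ker (d R X p)

/-- The coboundaries of degree `p`; there are no nonzero cochains in negative degree. -/
def coboundaries (R : Type*) [Ring R] (X : Type*) [TopologicalSpace X] :
    (p : ℕ) → Submodule R (Cochain R X p)
  | 0 => ⊥
  | p + 1 => LinearMap.range (d R X p)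

theorem coboundaries_le_cocycles (R : Type*) [Ring R] (X : Type*) [TopologicalSpace X] (p : ℕ) :
    coboundaries R X p ≤ cocycles R X p := by
  cases p with
  | zero => exact bot_le
  | succ p =>
    rintro _ ⟨c, rfl⟩
    exact d_d R X p c

/-- The Alexander–Spanier cohomology module of degree `p`: cocycles modulo coboundaries. -/
abbrev Cohomology (R : Type*) [Ring R] (X : Type*) [TopologicalSpace X] (p : ℕ) : Type _ :=
  cocycles R X p ⧸ (coboundaries R X p).submoduleOf (cocycles R X p)

section Pullback

variable (R : Type*) [Ring R] {X Y : Type*} [TopologicalSpace X] [TopologicalSpace Y]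

/-- `φ ↦ φ ∘ (f × ⋯ × f)`. -/
def funPullback (f : C(X, Y)) (p : ℕ) : Fun R Y p →ₗ[R] Fun R X p where
  toFun φ := fun x => φ (fun i => f (x i))
  map_add' _ _ := rfl
  map_smul' _ _ := rfl

theorem locallyZero_le_comap_funPullback (f : C(X, Y)) (p : ℕ) :
    locallyZero R Y p ≤ (locallyZero R X p).comap (funPullback R f p) := by
  intro φ hφ a
  obtain ⟨U, hU, hU0⟩ := hφ (f a)
  exact ⟨f ⁻¹' U, f.continuous.continuousAt hU, fun x hx => hU0 _ hx⟩

/-- The map induced by `f` on Alexander–Spanier cochains. -/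
def cochainPullback (f : C(X, Y)) (p : ℕ) : Cochain R Y p →ₗ[R] Cochain R X p :=
  (locallyZero R Y p).mapQ (locallyZero R X p) (funPullback R f p)
    (locallyZero_le_comap_funPullback R f p)

theorem d_cochainPullback (f : C(X, Y)) (p : ℕ) (c : Cochain R Y p) :
    d R X p (cochainPullback R f p c) = cochainPullback R f (p + 1) (d R Y p c) := by
  obtain ⟨φ, rfl⟩ := Submodule.mkQ_surjective _ c
  rfl

theorem cochainPullback_mem_cocycles (f : C(X, Y)) (p : ℕ) (c : Cochain R Y p)
    (hc : c ∈ cocycles R Y p) : cochainPullback R f p c ∈ cocycles R X p := by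
  have h : d R Y p c = 0 := hc
  change d R X p (cochainPullback R f p c) = 0
  rw [d_cochainPullback, h, map_zero]

theorem cochainPullback_mem_coboundaries (f : C(X, Y)) (p : ℕ) (c : Cochain R Y p)
    (hc : c ∈ coboundaries R Y p) : cochainPullback R f p c ∈ coboundaries R X p := by
  cases p with
  | zero =>
    have h : c = 0 := hc
    change cochainPullback R f 0 c = 0
    rw [h, map_zero]
  | succ p =>
    obtain ⟨b, rfl⟩ := hc
    exact ⟨cochainPullback R f p b, d_cochainPullback R f p b⟩

/-- The homomorphism `f^*` induced by `f` on Alexander–Spanier cohomology, in degree `p`. -/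
def pullback (f : C(X, Y)) (p : ℕ) : Cohomology R Y p →ₗ[R] Cohomology R X p :=
  Submodule.mapQ _ _
    ((cochainPullback R f p).restrict (cochainPullback_mem_cocycles R f p))
    (fun c hc => cochainPullback_mem_coboundaries R f p c hc)

end Pullback

end AlexanderSpanier

/-- The nerves of two families of sets indexed by `1, …, n` are naturally isomorphic: for every
nonempty set `s` of indices, `⋂ i ∈ s, C i` is nonempty if and only if `⋂ i ∈ s, C' i` is. -/
def NervesNaturallyIsomorphic {E E' : Type*} {n : ℕ} (C : Fin n → Set E) (C' : Fin n → Set E') :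
    Prop :=
  ∀ s : Finset (Fin n), s.Nonempty → ((⋂ i ∈ s, C i).Nonempty ↔ (⋂ i ∈ s, C' i).Nonempty)

/-! It suffices to find a continuous map `r` from $C'$ back to $C$ with $r(C'_i)\subset C_i$. Then
$r\circ q$ and $q\circ r$ preserve every convex piece, so segments inside the pieces join them to
the identities (`homotopic_id_of_mapsTo_convex`), and homotopy invariance makes $q^*$ bijective.

The map `r` comes from `exists_continuousMap_mapsTo_convex`: Urysohn functions for the $C'_i$ that
are jointly nonzero only where the pieces intersect give a partition of unity indexed by sets $s$ of
indices, and `r` averages chosen points of $\bigcap_{i\in s}C_i$ with these weights.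

Homotopy invariance (`pullback_eq_of_homotopy`) holds for arbitrary spaces. Cochains only matter
near the diagonal, so the prism homotopy on $X\times[0,1]$ has to consist of small tuples. It is
built by an acyclic carrier argument (`exists_chainHomotopy`), whose core is the acyclicity of the
small chains over a small set (`exists_boundary_eq_of_mem_chainsIn`). -/

namespace AlexanderSpanier

/-! ### The augmented complex of tuples and its cones. -/

/-- The integral chains on tuples of length `n`; the empty tuple is included, so that the complex
is augmented. -/
abbrev Chain (X : Type*) (n : ℕ) : Type _ := (Fin n → X) →₀ ℤ

/-- The boundary of the augmented complex of tuples. -/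
noncomputable def boundary (X : Type*) (n : ℕ) : Chain X (n + 1) →ₗ[ℤ] Chain X n :=
  Finsupp.linearCombination ℤ fun x : Fin (n + 1) → X =>
    ∑ i : Fin (n + 1), (-1 : ℤ) ^ (i : ℕ) • Finsupp.single (fun j => x (i.succAbove j)) (1 : ℤ)

/-- The chain map induced by a map of sets. -/
noncomputable def chainMap {X Y : Type*} (f : X → Y) (n : ℕ) : Chain X n →ₗ[ℤ] Chain Y n :=
  Finsupp.lmapDomain ℤ ℤ fun x j => f (x j)

/-- The cone with apex `b`. -/
noncomputable def cone {X : Type*} (b : X) (n : ℕ) : Chain X n →ₗ[ℤ] Chain X (n + 1) :=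
  Finsupp.lmapDomain ℤ ℤ fun x => (Fin.cons b x : Fin (n + 1) → X)

theorem boundary_single {X : Type*} {n : ℕ} (x : Fin (n + 1) → X) :
    boundary X n (Finsupp.single x 1) =
      ∑ i : Fin (n + 1), (-1 : ℤ) ^ (i : ℕ) •
        Finsupp.single (fun j => x (i.succAbove j)) (1 : ℤ) := by
  simp [boundary]

theorem chainMap_single {X Y : Type*} (f : X → Y) {n : ℕ} (x : Fin n → X) (m : ℤ) :
    chainMap f n (Finsupp.single x m) = Finsupp.single (fun j => f (x j)) m := by
  simp [chainMap]

theorem cone_single {X : Type*} (b : X) {n : ℕ} (x : Fin n → X) (m : ℤ) :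
    cone b n (Finsupp.single x m) = Finsupp.single (Fin.cons b x : Fin (n + 1) → X) m := by
  simp [cone]

theorem chain_hom_ext {X : Type*} {n : ℕ} {M : Type*} [AddCommGroup M] {f g : Chain X n →ₗ[ℤ] M}
    (h : ∀ x, f (Finsupp.single x 1) = g (Finsupp.single x 1)) : f = g := by
  ext x
  simpa using h x

theorem boundary_boundary {X : Type*} {n : ℕ} (c : Chain X (n + 2)) :
    boundary X n (boundary X (n + 1) c) = 0 := by
  suffices h : boundary X n ∘ₗ boundary X (n + 1) = 0 from LinearMap.congr_fun h c
  refine chain_hom_ext fun x => ?_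
  simp only [LinearMap.comp_apply, boundary_single, map_sum, map_smul, LinearMap.zero_apply,
    Finset.smul_sum, smul_smul, ← pow_add]
  rw [← Finset.sum_product']
  -- The involution exchanges the two orders of deleting the same two entries; their signs are
  -- opposite.
  refine Finset.sum_involution
    (fun ij _ => (ij.1.succAbove ij.2, ij.2.predAbove ij.1)) ?_ ?_ ?_ ?_
  · rintro ⟨i, j⟩ -
    have h1 : (fun k => x ((i.succAbove j).succAbove ((j.predAbove i).succAbove k))) =
        fun k => x (i.succAbove (j.succAbove k)) := by
      funext k
      rw [Fin.succAbove_succAbove_succAbove_predAbove]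
    have h2 : ((-1 : ℤ) ^ ((i.succAbove j : ℕ) + (j.predAbove i : ℕ))) =
        - (-1 : ℤ) ^ ((i : ℕ) + (j : ℕ)) := by
      rw [Fin.neg_one_pow_succAbove_add_predAbove]
    simp only [h1, h2, neg_smul, add_neg_cancel]
  · rintro ⟨i, j⟩ - - h
    exact Fin.succAbove_ne i j (congrArg Prod.fst h)
  · intros
    simp
  · rintro ⟨i, j⟩ -
    simp [Fin.succAbove_succAbove_predAbove, Fin.predAbove_predAbove_succAbove]

theorem boundary_chainMap {X Y : Type*} (f : X → Y) {n : ℕ} (c : Chain X (n + 1)) :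
    boundary Y n (chainMap f (n + 1) c) = chainMap f n (boundary X n c) := by
  suffices h : boundary Y n ∘ₗ chainMap f (n + 1) = chainMap f n ∘ₗ boundary X n from
    LinearMap.congr_fun h c
  refine chain_hom_ext fun x => ?_
  simp only [LinearMap.comp_apply, boundary_single, map_sum, map_smul, chainMap_single]

theorem boundary_cone {X : Type*} (b : X) {n : ℕ} (c : Chain X (n + 1)) :
    boundary X (n + 1) (cone b (n + 1) c) = c - cone b n (boundary X n c) := by
  suffices h : boundary X (n + 1) ∘ₗ cone b (n + 1) = LinearMap.id - cone b n ∘ₗ boundary X n from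
    LinearMap.congr_fun h c
  refine chain_hom_ext fun x => ?_
  simp only [LinearMap.comp_apply, boundary_single, map_sum, map_smul, cone_single,
    LinearMap.sub_apply, LinearMap.id_apply]
  rw [Fin.sum_univ_succ, sub_eq_add_neg, ← Finset.sum_neg_distrib]
  congr 1
  · simp
  · refine Finset.sum_congr rfl fun i _ => ?_
    have : (fun j => (Fin.cons b x : Fin (n + 2) → X) (i.succ.succAbove j)) =
        (Fin.cons b (fun j => x (i.succAbove j)) : Fin (n + 1) → X) := by
      funext j
      refine Fin.cases ?_ (fun j => ?_) j <;> simp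
    rw [this, Fin.val_succ, pow_succ]
    simp

/-! ### Chains with prescribed carriers. -/

/-- The chains on the tuples whose set of entries belongs to `𝒜`. -/
def chainsIn {X : Type*} (𝒜 : Set (Set X)) (n : ℕ) : Submodule ℤ (Chain X n) :=
  Finsupp.supported ℤ ℤ {x | Set.range x ∈ 𝒜}

theorem single_mem_chainsIn {X : Type*} {𝒜 : Set (Set X)} {n : ℕ} {x : Fin n → X}
    (h : Set.range x ∈ 𝒜) (m : ℤ) : Finsupp.single x m ∈ chainsIn 𝒜 n :=
  Finsupp.single_mem_supported ℤ m h

theorem map_mem_of_mem_chainsIn {X : Type*} {𝒜 : Set (Set X)} {n : ℕ} {M : Type*} [AddCommGroup M]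
    (f : Chain X n →ₗ[ℤ] M) (S : Submodule ℤ M) {c : Chain X n} (hc : c ∈ chainsIn 𝒜 n)
    (h : ∀ x ∈ c.support, Set.range x ∈ 𝒜 → f (Finsupp.single x 1) ∈ S) : f c ∈ S := by
  rw [← Finsupp.sum_single c, Finsupp.sum, map_sum]
  refine S.sum_mem fun x hx => ?_
  have : Finsupp.single x (c x) = c x • Finsupp.single x (1 : ℤ) := by simp
  rw [this, map_smul]
  exact S.smul_mem _ (h x hx ((Finsupp.mem_supported ℤ c).1 hc hx))

theorem chainsIn_mono {X : Type*} {𝒜 ℬ : Set (Set X)} (h : 𝒜 ⊆ ℬ) (n : ℕ) :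
    chainsIn 𝒜 n ≤ chainsIn ℬ n :=
  Finsupp.supported_mono fun _ hx => h hx

theorem boundary_single_mem_chainsIn {X : Type*} {n : ℕ} (x : Fin (n + 1) → X) :
    boundary X n (Finsupp.single x 1) ∈ chainsIn (Set.Iic (Set.range x)) n := by
  rw [boundary_single]
  refine Submodule.sum_mem _ fun i _ => Submodule.smul_mem _ _ (single_mem_chainsIn ?_ _)
  rintro _ ⟨j, rfl⟩
  exact ⟨_, rfl⟩

theorem cone_mem_chainsIn {X : Type*} {𝒜 : Set (Set X)} {b : X} {n : ℕ}
    (h : ∀ A ∈ 𝒜, insert b A ∈ 𝒜) {c : Chain X n} (hc : c ∈ chainsIn 𝒜 n) :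
    cone b n c ∈ chainsIn 𝒜 (n + 1) := by
  refine map_mem_of_mem_chainsIn _ _ hc fun x _ hx => ?_
  rw [cone_single]
  refine single_mem_chainsIn ?_ _
  rw [Fin.range_cons]
  exact h _ hx

theorem chainMap_mem_chainsIn {X Y : Type*} {𝒜 : Set (Set X)} {ℬ : Set (Set Y)} {f : X → Y} {n : ℕ}
    (h : ∀ A ∈ 𝒜, f '' A ∈ ℬ) {c : Chain X n} (hc : c ∈ chainsIn 𝒜 n) :
    chainMap f n c ∈ chainsIn ℬ n := by
  refine map_mem_of_mem_chainsIn _ _ hc fun x _ hx => ?_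
  rw [chainMap_single]
  refine single_mem_chainsIn ?_ _
  have := h _ hx
  rwa [← Set.range_comp] at this

/-! ### The cone homotopy between two maps of sets. -/

/-- A chain homotopy between the chain maps induced by `f` and `g`, made of cones. -/
noncomputable def coneHomotopy {X Y : Type*} (f g : X → Y) :
    (n : ℕ) → Chain X n →ₗ[ℤ] Chain Y (n + 1)
  | 0 => 0
  | n + 1 => Finsupp.linearCombination ℤ fun x : Fin (n + 1) → X =>
      cone (f (x 0)) (n + 1) (chainMap g (n + 1) (Finsupp.single x 1) -
        chainMap f (n + 1) (Finsupp.single x 1) -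
        coneHomotopy f g n (boundary X n (Finsupp.single x 1)))

theorem coneHomotopy_single {X Y : Type*} (f g : X → Y) {n : ℕ} (x : Fin (n + 1) → X) :
    coneHomotopy f g (n + 1) (Finsupp.single x 1) =
      cone (f (x 0)) (n + 1) (chainMap g (n + 1) (Finsupp.single x 1) -
        chainMap f (n + 1) (Finsupp.single x 1) -
        coneHomotopy f g n (boundary X n (Finsupp.single x 1))) := by
  simp [coneHomotopy]

/-- The chain being coned is a cycle, by the same formula one degree lower, and the cone over a
cycle bounds that cycle. -/
theorem boundary_coneHomotopy {X Y : Type*} (f g : X → Y) {n : ℕ} (c : Chain X (n + 1)) :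
    boundary Y (n + 1) (coneHomotopy f g (n + 1) c) =
      chainMap g (n + 1) c - chainMap f (n + 1) c - coneHomotopy f g n (boundary X n c) := by
  suffices h : boundary Y (n + 1) ∘ₗ coneHomotopy f g (n + 1) =
      chainMap g (n + 1) - chainMap f (n + 1) - coneHomotopy f g n ∘ₗ boundary X n from
    LinearMap.congr_fun h c
  clear c
  induction n with
  | zero =>
    refine chain_hom_ext fun x => ?_
    rw [LinearMap.comp_apply, coneHomotopy_single, boundary_cone]
    simp only [LinearMap.sub_apply, LinearMap.comp_apply, map_sub, boundary_chainMap]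
    -- In the lowest degree the cycle condition is augmentation: both maps send the empty tuple to
    -- itself.
    rw [sub_eq_self, boundary_single, map_sum, map_sum]
    simp [chainMap_single, coneHomotopy, Subsingleton.elim _ (default : Fin 0 → Y)]
  | succ n ih =>
    refine chain_hom_ext fun x => ?_
    rw [LinearMap.comp_apply, coneHomotopy_single, boundary_cone]
    simp only [LinearMap.sub_apply, LinearMap.comp_apply]
    rw [sub_eq_self]
    have h := LinearMap.congr_fun ih (boundary X (n + 1) (Finsupp.single x 1))
    simp only [LinearMap.sub_apply, LinearMap.comp_apply, boundary_boundary, map_zero,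
      sub_zero] at h
    rw [map_sub, h, map_sub (boundary Y (n + 1)), boundary_chainMap, boundary_chainMap, sub_self,
      map_zero]

/-- All apexes are values of `f`, so no entries other than values of `f` and `g` appear. This keeps
the homotopy between two nearby truncations small. -/
theorem coneHomotopy_mem_chainsIn {X Y : Type*} (f g : X → Y) {n : ℕ} (x : Fin n → X) :
    coneHomotopy f g n (Finsupp.single x 1) ∈
      chainsIn (Set.Iic (f '' Set.range x ∪ g '' Set.range x)) (n + 1) := by
  induction n with
  | zero => simp [coneHomotopy]
  | succ n ih =>
    rw [coneHomotopy_single]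
    refine cone_mem_chainsIn (fun A hA => ?_) (Submodule.sub_mem _ (Submodule.sub_mem _ ?_ ?_) ?_)
    · exact Set.insert_subset (Or.inl ⟨_, ⟨0, rfl⟩, rfl⟩) hA
    · rw [chainMap_single]
      refine single_mem_chainsIn ?_ _
      rintro _ ⟨j, rfl⟩
      exact Or.inr ⟨_, ⟨j, rfl⟩, rfl⟩
    · rw [chainMap_single]
      refine single_mem_chainsIn ?_ _
      rintro _ ⟨j, rfl⟩
      exact Or.inl ⟨_, ⟨j, rfl⟩, rfl⟩
    · refine map_mem_of_mem_chainsIn _ _ (boundary_single_mem_chainsIn x) fun y _ hy => ?_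
      exact chainsIn_mono (Set.Iic_subset_Iic.2
        (Set.union_subset_union (Set.image_mono hy) (Set.image_mono hy))) _ (ih y)

/-! ### Small chains on the cylinder and the prism homotopy. -/

/-- The sets of points of `X × [0, 1]` which are small with respect to a neighbourhood `V a` and
a length `ε a` for some `a`. -/
def smallSets {X : Type*} (V : X → Set X) (ε : X → ℝ) : Set (Set (X × unitInterval)) :=
  {A | ∃ a, (∀ w ∈ A, w.1 ∈ V a) ∧ ∀ w ∈ A, ∀ w' ∈ A, |(w.2 : ℝ) - w'.2| < ε a}

/-- The sets in `smallSets V ε` which lie over `s`. -/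
def smallSetsOver {X : Type*} (V : X → Set X) (ε : X → ℝ) (s : Set X) :
    Set (Set (X × unitInterval)) :=
  {A | A ∈ smallSets V ε ∧ ∀ w ∈ A, w.1 ∈ s}

theorem smallSetsOver_mono {X : Type*} (V : X → Set X) (ε : X → ℝ) {s t : Set X} (h : s ⊆ t) :
    smallSetsOver V ε s ⊆ smallSetsOver V ε t :=
  fun _ hA => ⟨hA.1, fun w hw => h (hA.2 w hw)⟩

theorem mem_smallSetsOver_of_subset {X : Type*} {V : X → Set X} {ε : X → ℝ} {s : Set X}
    {A B : Set (X × unitInterval)} (hA : A ∈ smallSetsOver V ε s) (h : B ⊆ A) :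
    B ∈ smallSetsOver V ε s := by
  obtain ⟨⟨a, h1, h2⟩, h3⟩ := hA
  exact ⟨⟨a, fun w hw => h1 w (h hw), fun w hw w' hw' => h2 w (h hw) w' (h hw')⟩,
    fun w hw => h3 w (h hw)⟩

/-- The map of `X × [0, 1]` which truncates the second coordinate at `c`. -/
def truncate (X : Type*) (c : unitInterval) (w : X × unitInterval) : X × unitInterval :=
  (w.1, min w.2 c)

theorem truncate_union_mem_smallSetsOver {X : Type*} {V : X → Set X} {ε : X → ℝ} {s : Set X}
    {A : Set (X × unitInterval)} {a : X} (hV : ∀ w ∈ A, w.1 ∈ V a)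
    (hε : ∀ w ∈ A, ∀ w' ∈ A, |(w.2 : ℝ) - w'.2| < ε a) (hs : ∀ w ∈ A, w.1 ∈ s)
    {c c' : unitInterval} (hc : |(c : ℝ) - c'| < ε a) :
    truncate X c '' A ∪ truncate X c' '' A ∈ smallSetsOver V ε s := by
  have key : ∀ v ∈ truncate X c '' A ∪ truncate X c' '' A,
      ∃ w ∈ A, ∃ e : unitInterval, (e = c ∨ e = c') ∧ truncate X e w = v := by
    rintro v (⟨w, hw, rfl⟩ | ⟨w, hw, rfl⟩)
    · exact ⟨w, hw, c, Or.inl rfl, rfl⟩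
    · exact ⟨w, hw, c', Or.inr rfl, rfl⟩
  have h0 : 0 < ε a := (abs_nonneg _).trans_lt hc
  refine ⟨⟨a, fun v hv => ?_, fun v hv v' hv' => ?_⟩, fun v hv => ?_⟩
  · obtain ⟨w, hw, e, -, rfl⟩ := key v hv
    exact hV w hw
  · obtain ⟨w, hw, e, he, rfl⟩ := key v hv
    obtain ⟨w', hw', e', he', rfl⟩ := key v' hv'
    have h1 : |(e : ℝ) - e'| < ε a := by
      rcases he with rfl | rfl <;> rcases he' with rfl | rfl
      · simpa using h0
      · exact hc
      · rwa [abs_sub_comm]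
      · simpa using h0
    change |((min w.2 e : unitInterval) : ℝ) - (min w'.2 e' : unitInterval)| < ε a
    have hmin : ∀ u v : unitInterval, ((min u v : unitInterval) : ℝ) = min (u : ℝ) v :=
      fun u v => Monotone.map_min (f := fun t : unitInterval => (t : ℝ)) fun _ _ h => h
    rw [hmin, hmin]
    exact (abs_min_sub_min_le_max _ _ _ _).trans_lt (max_lt (hε w hw w' hw') h1)
  · obtain ⟨w, hw, e, -, rfl⟩ := key v hv
    exact hs w hw

/-- A direct cone over `z` need not be small in the interval direction. Instead `z` is pushed down
to height 0 by truncations at closely spaced levels, each step being a small homotopy; at height 0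
all of $s$ is small, so a cone finishes. -/
theorem exists_boundary_eq_of_mem_chainsIn {X : Type*} {V : X → Set X} {ε : X → ℝ}
    (hε : ∀ a, 0 < ε a) {s : Set X} (hs : ∃ a, s ⊆ V a) (hne : s.Nonempty) {n : ℕ}
    {z : Chain (X × unitInterval) (n + 1)} (hz : z ∈ chainsIn (smallSetsOver V ε s) (n + 1))
    (hz0 : boundary _ n z = 0) :
    ∃ c ∈ chainsIn (smallSetsOver V ε s) (n + 2), boundary _ (n + 1) c = z := by
  set S := chainsIn (smallSetsOver V ε s) (n + 2)
  have hstep : ∃ N : ℕ, 0 < N ∧ ∀ c c' : unitInterval, |(c : ℝ) - c'| ≤ 1 / N →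
      ∃ b ∈ S, boundary _ (n + 1) b =
        chainMap (truncate X c') (n + 1) z - chainMap (truncate X c) (n + 1) z := by
    have h : ∀ x ∈ z.support, ∃ a, ((∀ w ∈ Set.range x, w.1 ∈ V a) ∧
        ∀ w ∈ Set.range x, ∀ w' ∈ Set.range x, |(w.2 : ℝ) - w'.2| < ε a) ∧
        ∀ w ∈ Set.range x, w.1 ∈ s := by
      intro x hx
      obtain ⟨⟨a, ha⟩, h⟩ := (Finsupp.mem_supported ℤ z).1 hz hx
      exact ⟨a, ha, h⟩
    have : Nonempty X := ⟨hne.some⟩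
    choose! a ha using h
    -- A chain has finite support, so one step length $1/N$ suits all its tuples.
    have hN : ∀ᶠ N : ℕ in Filter.atTop, 0 < N ∧ ∀ x ∈ z.support, 1 / (N : ℝ) < ε (a x) := by
      refine (Filter.eventually_gt_atTop 0).and ((Filter.eventually_all_finset _).2 fun x _ => ?_)
      exact tendsto_one_div_atTop_nhds_zero_nat.eventually_lt_const (hε _)
    obtain ⟨N, hN0, hN⟩ := hN.exists
    refine ⟨N, hN0, fun c c' hc => ⟨coneHomotopy (truncate X c) (truncate X c') (n + 1) z, ?_, ?_⟩⟩
    · refine map_mem_of_mem_chainsIn _ _ hz fun x hx _ => ?_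
      refine chainsIn_mono ?_ _ (coneHomotopy_mem_chainsIn (truncate X c) (truncate X c') x)
      intro B hB
      refine mem_smallSetsOver_of_subset ?_ hB
      obtain ⟨⟨h1, h2⟩, h3⟩ := ha x hx
      exact truncate_union_mem_smallSetsOver h1 h2 h3 (hc.trans_lt (hN x hx))
    · rw [boundary_coneHomotopy, hz0, map_zero, sub_zero]
  obtain ⟨N, hN0, hN⟩ := hstep
  -- Clamping makes the levels total in `k` without increasing distances.
  let c : ℕ → unitInterval := fun k => Set.projIcc 0 1 zero_le_one ((k : ℝ) / N)
  have hc : ∀ k, ∃ b ∈ S, boundary _ (n + 1) b =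
      chainMap (truncate X (c k)) (n + 1) z - chainMap (truncate X 0) (n + 1) z := by
    intro k
    induction k with
    | zero =>
      have : c 0 = 0 := by simp [c]
      exact ⟨0, S.zero_mem, by simp [this]⟩
    | succ k ih =>
      obtain ⟨b, hb, hb'⟩ := ih
      obtain ⟨e, he, he'⟩ := hN (c k) (c (k + 1)) (by
        refine (Set.abs_projIcc_sub_projIcc zero_le_one).trans ?_
        rw [← sub_div, abs_div]
        simp)
      exact ⟨b + e, S.add_mem hb he, by rw [map_add, hb', he']; abel⟩
  obtain ⟨b, hb, hb'⟩ := hc N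
  have hcN : c N = 1 := by
    have : (N : ℝ) ≠ 0 := by positivity
    simp [c, this]
  have hid : chainMap (truncate X 1) (n + 1) z = z := by
    have : truncate X 1 = id := by
      funext w
      exact Prod.ext rfl (min_eq_left w.2.2.2)
    rw [this]
    exact Finsupp.mapDomain_id
  rw [hcN, hid] at hb'
  obtain ⟨x₀, hx₀⟩ := hne
  obtain ⟨a, ha⟩ := hs
  -- Unlike general small sets, the sets at height 0 over $s$ remain such when the apex `(x₀, 0)` is
  -- added.
  let 𝒵 : Set (Set (X × unitInterval)) := {A | ∀ w ∈ A, w.1 ∈ s ∧ w.2 = 0}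
  have h𝒵 : 𝒵 ⊆ smallSetsOver V ε s := fun A hA =>
    ⟨⟨a, fun w hw => ha (hA w hw).1, fun w hw w' hw' => by
      rw [(hA w hw).2, (hA w' hw').2, sub_self, abs_zero]; exact hε a⟩, fun w hw => (hA w hw).1⟩
  refine ⟨b + cone (x₀, 0) (n + 1) (chainMap (truncate X 0) (n + 1) z), S.add_mem hb ?_, ?_⟩
  · refine chainsIn_mono h𝒵 _ (cone_mem_chainsIn (fun A hA => ?_)
      (chainMap_mem_chainsIn (fun A hA => ?_) hz))
    · rintro w (rfl | hw)
      · exact ⟨hx₀, rfl⟩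
      · exact hA w hw
    · rintro _ ⟨w, hw, rfl⟩
      exact ⟨hA.2 w hw, min_eq_right w.2.2.1⟩
  · rw [map_add, hb', boundary_cone, boundary_chainMap, hz0, map_zero, map_zero]
    abel

/-- The chain maps induced by the two ends of `X × [0, 1]` are homotopic, by a homotopy carried by
small sets. -/
theorem exists_chainHomotopy {X : Type*} (V : X → Set X) {ε : X → ℝ} (hε : ∀ a, 0 < ε a) (n : ℕ) :
    ∃ (D : Chain X n →ₗ[ℤ] Chain (X × unitInterval) (n + 1))
      (D' : Chain X (n + 1) →ₗ[ℤ] Chain (X × unitInterval) (n + 2)), (n = 0 → D = 0) ∧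
      ∀ x : Fin (n + 1) → X, (∃ a, Set.range x ⊆ V a) →
        D' (Finsupp.single x 1) ∈ chainsIn (smallSetsOver V ε (Set.range x)) (n + 2) ∧
        boundary _ (n + 1) (D' (Finsupp.single x 1)) =
          Finsupp.single (fun j => (x j, 1)) 1 - Finsupp.single (fun j => (x j, 0)) 1 -
            D (boundary X n (Finsupp.single x 1)) := by
  -- One step of the acyclic carrier construction: the prescribed boundary is a small cycle over
  -- `Set.range x`, hence can be filled there. Values on tuples that are not small are irrelevant.
  have ext : ∀ (n : ℕ) (D : Chain X n →ₗ[ℤ] Chain (X × unitInterval) (n + 1)),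
      (∀ x : Fin (n + 1) → X, (∃ a, Set.range x ⊆ V a) →
        D (boundary X n (Finsupp.single x 1)) ∈
          chainsIn (smallSetsOver V ε (Set.range x)) (n + 1) ∧
        boundary _ n (D (boundary X n (Finsupp.single x 1))) =
          boundary _ n (Finsupp.single (fun j => (x j, 1)) 1 -
            Finsupp.single (fun j => (x j, 0)) 1)) →
      ∃ D' : Chain X (n + 1) →ₗ[ℤ] Chain (X × unitInterval) (n + 2),
        ∀ x : Fin (n + 1) → X, (∃ a, Set.range x ⊆ V a) →
        D' (Finsupp.single x 1) ∈ chainsIn (smallSetsOver V ε (Set.range x)) (n + 2) ∧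
        boundary _ (n + 1) (D' (Finsupp.single x 1)) =
          Finsupp.single (fun j => (x j, 1)) 1 - Finsupp.single (fun j => (x j, 0)) 1 -
            D (boundary X n (Finsupp.single x 1)) := by
    intro n D hD
    have h : ∀ x : Fin (n + 1) → X, (∃ a, Set.range x ⊆ V a) →
        ∃ c ∈ chainsIn (smallSetsOver V ε (Set.range x)) (n + 2), boundary _ (n + 1) c =
          Finsupp.single (fun j => (x j, 1)) 1 - Finsupp.single (fun j => (x j, 0)) 1 -
            D (boundary X n (Finsupp.single x 1)) := by
      intro x hx
      obtain ⟨h1, h2⟩ := hD x hx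
      have hend : ∀ t : unitInterval, Finsupp.single (fun j => (x j, t)) (1 : ℤ) ∈
          chainsIn (smallSetsOver V ε (Set.range x)) (n + 1) := by
        obtain ⟨a, ha⟩ := hx
        refine fun t => single_mem_chainsIn (𝒜 := smallSetsOver V ε (Set.range x))
          ⟨⟨a, ?_, ?_⟩, ?_⟩ _
        · rintro _ ⟨j, rfl⟩
          exact ha ⟨j, rfl⟩
        · rintro _ ⟨j, rfl⟩ _ ⟨k, rfl⟩
          simpa using hε a
        · rintro _ ⟨j, rfl⟩
          exact ⟨j, rfl⟩
      exact exists_boundary_eq_of_mem_chainsIn hε hx (Set.range_nonempty x)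
        (Submodule.sub_mem _ (Submodule.sub_mem _ (hend 1) (hend 0)) h1)
        (by rw [map_sub, h2, sub_self])
    choose! c hc using h
    exact ⟨Finsupp.linearCombination ℤ c, fun x hx => by simpa using hc x hx⟩
  induction n with
  | zero =>
    obtain ⟨D', hD'⟩ := ext 0 0 (by
      refine fun x _ => ⟨Submodule.zero_mem _, ?_⟩
      simp [boundary_single, Subsingleton.elim _ (default : Fin 0 → X × unitInterval)])
    exact ⟨0, D', fun _ => rfl, hD'⟩
  | succ n ih =>
    obtain ⟨D, D', -, hD⟩ := ih
    obtain ⟨D'', hD''⟩ := ext (n + 1) D' (by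
      rintro x ⟨a, ha⟩
      have hface : ∀ i : Fin (n + 2), Set.range (fun j => x (i.succAbove j)) ⊆ Set.range x := by
        rintro i _ ⟨j, rfl⟩
        exact ⟨_, rfl⟩
      constructor
      · refine map_mem_of_mem_chainsIn _ _ (boundary_single_mem_chainsIn x) fun y _ hy => ?_
        exact chainsIn_mono (smallSetsOver_mono V ε hy) _ (hD y ⟨a, subset_trans hy ha⟩).1
      · have h : boundary _ (n + 1) (D' (boundary X (n + 1) (Finsupp.single x 1))) =
            chainMap (fun y => (y, 1)) (n + 1) (boundary X (n + 1) (Finsupp.single x 1)) -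
            chainMap (fun y => (y, 0)) (n + 1) (boundary X (n + 1) (Finsupp.single x 1)) -
              D (boundary X n (boundary X (n + 1) (Finsupp.single x 1))) := by
          rw [boundary_single]
          simp only [map_sum, map_smul, ← Finset.sum_sub_distrib, ← smul_sub]
          refine Finset.sum_congr rfl fun i _ => ?_
          rw [(hD _ ⟨a, (hface i).trans ha⟩).2, chainMap_single, chainMap_single]
        rw [h, boundary_boundary, map_zero, sub_zero, ← boundary_chainMap, ← boundary_chainMap,
          chainMap_single, chainMap_single, map_sub])
    exact ⟨D', D'', fun h => absurd h n.succ_ne_zero, hD''⟩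

/-! ### Pairing with chains and the homotopy axiom. -/

/-- The value of a cochain on a chain. -/
noncomputable def pairing {R : Type*} [Ring R] {X : Type*} {n : ℕ} (φ : (Fin n → X) → R) :
    Chain X n →ₗ[ℤ] R :=
  Finsupp.linearCombination ℤ φ

theorem pairing_single {R : Type*} [Ring R] {X : Type*} {n : ℕ} (φ : (Fin n → X) → R)
    (x : Fin n → X) : pairing φ (Finsupp.single x 1) = φ x := by
  simp [pairing]

theorem funD_apply (R : Type*) [Ring R] {X : Type*} {p : ℕ} (φ : Fun R X p) (x : Fin (p + 2) → X) :
    funD R X p φ x = ∑ i : Fin (p + 2), (-1 : ℤ) ^ (i : ℕ) • φ (fun j => x (i.succAbove j)) :=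
  rfl

theorem pairing_funD {R : Type*} [Ring R] {X : Type*} {p : ℕ} (φ : Fun R X p)
    (c : Chain X (p + 2)) : pairing (funD R X p φ) c = pairing φ (boundary X (p + 1) c) := by
  suffices h : pairing (funD R X p φ) = pairing φ ∘ₗ boundary X (p + 1) from LinearMap.congr_fun h c
  refine chain_hom_ext fun x => ?_
  simp only [LinearMap.comp_apply, boundary_single, map_sum, map_smul, pairing_single, funD_apply]

/-- Compactness of the interval: finitely many product neighbourhoods cover $\{a\}\times[0,1]$; `V`
is the intersection of their bases and `ε` a Lebesgue number of their heights. -/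
theorem exists_tube {X : Type*} [TopologicalSpace X] (a : X)
    (W : unitInterval → Set (X × unitInterval))
    (hW : ∀ t, W t ∈ 𝓝 (a, t)) :
    ∃ V ∈ 𝓝 a, ∃ ε : ℝ, 0 < ε ∧ ∀ A : Set (X × unitInterval), A.Nonempty → (∀ w ∈ A, w.1 ∈ V) →
      (∀ w ∈ A, ∀ w' ∈ A, |(w.2 : ℝ) - w'.2| < ε) → ∃ t, A ⊆ W t := by
  have h : ∀ t, ∃ U ∈ 𝓝 a, ∃ B ∈ 𝓝 t, U ×ˢ B ⊆ W t := fun t => mem_nhds_prod_iff.1 (hW t)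
  choose U hU B hB hUB using h
  obtain ⟨T, -, hT⟩ := isCompact_univ.elim_nhds_subcover (fun t => interior (B t))
    (fun t _ => interior_mem_nhds.2 (hB t))
  obtain ⟨ε, hε, hball⟩ := lebesgue_number_lemma_of_metric (c := fun t : T => interior (B t))
    isCompact_univ (fun t => isOpen_interior) (by simpa [Set.iUnion_subtype] using hT)
  refine ⟨⋂ t ∈ T, U t, (Filter.biInter_finset_mem T).2 fun t _ => hU t, ε, hε, ?_⟩
  rintro A ⟨w₀, hw₀⟩ h1 h2
  obtain ⟨t, ht⟩ := hball w₀.2 (Set.mem_univ _)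
  refine ⟨t, fun w hw => hUB t ⟨Set.mem_iInter₂.1 (h1 w hw) t t.2, interior_subset (ht ?_)⟩⟩
  exact h2 w hw w₀ hw₀

variable (R : Type*) [Ring R] {X Y : Type*} [TopologicalSpace X] [TopologicalSpace Y]

/-- Pulled back to the cylinder, the coboundary of `φ` kills small chains. Evaluating it on the
prism over a small tuple `x` gives $g^*\varphi-f^*\varphi=\varphi'(D\,\partial x)$, which is locally
the coboundary of $y\mapsto\varphi'(Dy)$. -/
theorem mkQ_sub_mem_coboundaries {f g : C(X, Y)} (H : f.Homotopy g) {p : ℕ} {φ : Fun R Y p}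
    (hφ : funD R Y p φ ∈ locallyZero R Y (p + 1)) :
    (locallyZero R X p).mkQ (funPullback R g p φ - funPullback R f p φ) ∈ coboundaries R X p := by
  have h : ∀ a : X, ∃ V ∈ 𝓝 a, ∃ ε : ℝ, 0 < ε ∧ ∀ w : Fin (p + 2) → X × unitInterval,
      (∀ i, (w i).1 ∈ V) → (∀ i j, |((w i).2 : ℝ) - (w j).2| < ε) →
      funD R Y p φ (fun j => H ((w j).2, (w j).1)) = 0 := by
    intro a
    choose U hU hU0 using hφ
    obtain ⟨V, hV, ε, hε, h⟩ := exists_tube a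
      (fun t => {w | H (w.2, w.1) ∈ U (H (t, a))}) (fun t => by
        have : ContinuousAt (fun w : X × unitInterval => H (w.2, w.1)) (a, t) :=
          (H.continuous.comp continuous_swap).continuousAt
        exact this (hU _))
    refine ⟨V, hV, ε, hε, fun w h1 h2 => ?_⟩
    obtain ⟨t, ht⟩ := h (Set.range w) (Set.range_nonempty w) (by rintro _ ⟨i, rfl⟩; exact h1 i)
      (by rintro _ ⟨i, rfl⟩ _ ⟨j, rfl⟩; exact h2 i j)
    exact hU0 _ _ fun i => ht ⟨i, rfl⟩
  choose V hV ε hε hsmall using h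
  obtain ⟨D, D', hD0, hD'⟩ := exists_chainHomotopy V hε p
  let φ' : Fun R (X × unitInterval) p := fun w => φ fun j => H ((w j).2, (w j).1)
  have hφ' : ∀ c ∈ chainsIn (smallSets V ε) (p + 2), pairing (funD R _ p φ') c = 0 := by
    intro c hc
    refine map_mem_of_mem_chainsIn (pairing (funD R _ p φ')) ⊥ hc fun w _ hw => ?_
    obtain ⟨a, h1, h2⟩ := hw
    rw [pairing_single]
    exact hsmall a w (fun i => h1 _ ⟨i, rfl⟩) fun i j => h2 _ ⟨i, rfl⟩ _ ⟨j, rfl⟩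
  have hmain : ∀ x : Fin (p + 1) → X, (∃ a, Set.range x ⊆ V a) →
      (funPullback R g p φ - funPullback R f p φ) x =
        pairing φ' (D (boundary X p (Finsupp.single x 1))) := by
    intro x hx
    obtain ⟨h1, h2⟩ := hD' x hx
    have h3 := hφ' _ (chainsIn_mono (fun A hA => hA.1) _ h1)
    rw [pairing_funD, h2, map_sub, map_sub, pairing_single, pairing_single, sub_eq_zero] at h3
    rw [← h3]
    simp [φ', funPullback]
  -- In degree 0 there are no coboundaries; there `D = 0` makes the difference itself locally zero.
  cases p with
  | zero =>
    change _ = _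
    rw [Submodule.mkQ_apply, Submodule.Quotient.mk_eq_zero]
    refine fun a => ⟨V a, hV a, fun x hx => ?_⟩
    rw [hmain x ⟨a, by rintro _ ⟨i, rfl⟩; exact hx i⟩, hD0 rfl, LinearMap.zero_apply, map_zero]
  | succ p =>
    refine ⟨(locallyZero R X p).mkQ fun x => pairing φ' (D (Finsupp.single x 1)), ?_⟩
    change (locallyZero R X (p + 1)).mkQ (funD R X p _) = _
    rw [← sub_eq_zero, ← map_sub, Submodule.mkQ_apply, Submodule.Quotient.mk_eq_zero]
    refine fun a => ⟨V a, hV a, fun x hx => ?_⟩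
    rw [Pi.sub_apply, hmain x ⟨a, by rintro _ ⟨i, rfl⟩; exact hx i⟩, funD_apply, boundary_single]
    simp only [map_sum, map_smul, sub_self]

/-- The homotopy axiom for Alexander–Spanier cohomology. -/
theorem pullback_eq_of_homotopy {f g : C(X, Y)} (H : f.Homotopy g) (p : ℕ) :
    pullback R f p = pullback R g p := by
  refine LinearMap.ext fun c => ?_
  obtain ⟨⟨c, hc⟩, rfl⟩ := Submodule.mkQ_surjective _ c
  obtain ⟨φ, rfl⟩ := Submodule.mkQ_surjective _ c
  have hφ : funD R Y p φ ∈ locallyZero R Y (p + 1) := (Submodule.Quotient.mk_eq_zero _).1 hc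
  refine Eq.symm ((Submodule.Quotient.eq _).2 ?_)
  exact mkQ_sub_mem_coboundaries R H hφ

theorem pullback_id (p : ℕ) (c : Cohomology R X p) : pullback R (ContinuousMap.id X) p c = c := by
  obtain ⟨⟨c, hc⟩, rfl⟩ := Submodule.mkQ_surjective _ c
  obtain ⟨φ, rfl⟩ := Submodule.mkQ_surjective _ c
  rfl

theorem pullback_comp {Z : Type*} [TopologicalSpace Z] (g : C(Y, Z)) (f : C(X, Y)) (p : ℕ)
    (c : Cohomology R Z p) : pullback R (g.comp f) p c = pullback R f p (pullback R g p c) := by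
  obtain ⟨⟨c, hc⟩, rfl⟩ := Submodule.mkQ_surjective _ c
  obtain ⟨φ, rfl⟩ := Submodule.mkQ_surjective _ c
  rfl

theorem pullback_bijective_of_homotopyInverse {f : C(X, Y)} {g : C(Y, X)}
    (hgf : (g.comp f).Homotopic (ContinuousMap.id X))
    (hfg : (f.comp g).Homotopic (ContinuousMap.id Y)) (p : ℕ) :
    Function.Bijective (pullback R f p) := by
  obtain ⟨H⟩ := hgf
  obtain ⟨K⟩ := hfg
  refine Function.bijective_iff_has_inverse.2 ⟨pullback R g p, fun c => ?_, fun c => ?_⟩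
  · rw [← pullback_comp, pullback_eq_of_homotopy R K, pullback_id]
  · rw [← pullback_comp, pullback_eq_of_homotopy R H, pullback_id]

end AlexanderSpanier

/-! ### Maps between unions of convex sets. -/

/-- A self-map preserving each member of a family of convex sets is homotopic to the identity. -/
theorem homotopic_id_of_mapsTo_convex {E : Type*} [AddCommGroup E] [Module ℝ E]
    [TopologicalSpace E] [IsTopologicalAddGroup E] [ContinuousSMul ℝ E] {ι : Type*} {C : ι → Set E}
    (hconv : ∀ i, Convex ℝ (C i)) (f : C(↥(⋃ j, C j), ↥(⋃ j, C j)))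
    (hf : ∀ i, ∀ x : ↥(⋃ j, C j), (x : E) ∈ C i → (f x : E) ∈ C i) :
    f.Homotopic (ContinuousMap.id _) := by
  have hmem : ∀ w : unitInterval × ↥(⋃ j, C j),
      (1 - (w.1 : ℝ)) • (f w.2 : E) + (w.1 : ℝ) • (w.2 : E) ∈ ⋃ j, C j := by
    rintro ⟨t, x⟩
    obtain ⟨i, hi⟩ := Set.mem_iUnion.1 x.2
    exact Set.mem_iUnion.2 ⟨i, hconv i (hf i x hi) hi (sub_nonneg.2 t.2.2) t.2.1 (by simp)⟩
  exact ⟨{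
    toFun := fun w => ⟨_, hmem w⟩
    continuous_toFun := by
      refine Continuous.subtype_mk ?_ _
      fun_prop
    map_zero_left := fun x => Subtype.ext (by simp)
    map_one_left := fun x => Subtype.ext (by simp) }⟩

/-- A finite family of closed sets with empty intersection in a normal space has Urysohn functions
without a common point of their supports. -/
theorem exists_continuous_one_on_of_iInter_eq_empty {X : Type*} [TopologicalSpace X] [NormalSpace X]
    {ι : Type*} [Finite ι] {F : ι → Set X} (hF : ∀ i, IsClosed (F i)) (hempty : ⋂ i, F i = ∅) :
    ∃ μ : ι → C(X, ℝ), (∀ i x, μ i x ∈ Set.Icc (0 : ℝ) 1) ∧ (∀ i, ∀ x ∈ F i, μ i x = 1) ∧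
      ∀ x, ∃ i, μ i x = 0 := by
  -- The complements of the `F i` form an open cover; by normality it shrinks to a closed cover `K`,
  -- on whose members the Urysohn functions vanish.
  obtain ⟨K, hK, hKc, hKF⟩ := exists_iUnion_eq_closed_subset (u := fun i => (F i)ᶜ)
    (fun i => (hF i).isOpen_compl) (fun x => Set.toFinite _)
    (by rw [← Set.compl_iInter, hempty, Set.compl_empty])
  have h : ∀ i, ∃ μ : C(X, ℝ), Set.EqOn μ 0 (K i) ∧ Set.EqOn μ 1 (F i) ∧
      ∀ x, μ x ∈ Set.Icc (0 : ℝ) 1 := fun i =>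
    exists_continuous_zero_one_of_isClosed (hKc i) (hF i)
      (Set.disjoint_left.2 fun x hx => hKF i hx)
  choose μ h0 h1 hI using h
  refine ⟨μ, hI, fun i x hx => h1 i hx, fun x => ?_⟩
  obtain ⟨i, hi⟩ := Set.mem_iUnion.1 (hK ▸ Set.mem_univ x)
  exact ⟨i, h0 i hi⟩

/-- Urysohn functions of a finite closed family whose supports have the same nerve. -/
theorem exists_continuous_one_on_of_nerve {X : Type*} [TopologicalSpace X] [NormalSpace X]
    {ι : Type*} [Finite ι] {F : ι → Set X} (hF : ∀ i, IsClosed (F i)) :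
    ∃ l : ι → C(X, ℝ), (∀ i x, l i x ∈ Set.Icc (0 : ℝ) 1) ∧ (∀ i, ∀ x ∈ F i, l i x = 1) ∧
      ∀ (x : X) (s : Finset ι), (∀ i ∈ s, l i x ≠ 0) → (⋂ i ∈ s, F i).Nonempty := by
  classical
  have := Fintype.ofFinite ι
  have h : ∀ s : Finset ι, ∃ μ : ι → C(X, ℝ), (∀ i x, μ i x ∈ Set.Icc (0 : ℝ) 1) ∧
      (∀ i, ∀ x ∈ F i, μ i x = 1) ∧ (⋂ i ∈ s, F i = ∅ → ∀ x, ∃ i ∈ s, μ i x = 0) := by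
    intro s
    by_cases hs : ⋂ i ∈ s, F i = ∅
    · obtain ⟨μ, hI, h1, h0⟩ := exists_continuous_one_on_of_iInter_eq_empty
        (F := fun i : s => F i) (fun i => hF i) (by rw [← hs, Set.iInter_subtype])
      refine ⟨fun i => if hi : i ∈ s then μ ⟨i, hi⟩ else 1, fun i x => ?_, fun i x hx => ?_,
        fun _ x => ?_⟩
      · by_cases hi : i ∈ s
        · simpa [hi] using hI ⟨i, hi⟩ x
        · simp [hi]
      · by_cases hi : i ∈ s
        · simpa [hi] using h1 ⟨i, hi⟩ x hx
        · simp [hi]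
      · obtain ⟨i, hi⟩ := h0 x
        exact ⟨i, i.2, by simpa using hi⟩
    · exact ⟨fun _ => 1, fun _ _ => by simp, fun _ _ _ => rfl, fun h => absurd h hs⟩
  choose μ hI h1 h0 using h
  -- A product over all `s` vanishes wherever one factor does, so it handles every empty
  -- intersection at once and is still 1 on `F i`.
  refine ⟨fun i => ∏ s : Finset ι, μ s i, fun i x => ?_, fun i x hx => ?_, fun x s hs => ?_⟩
  · rw [ContinuousMap.prod_apply]
    exact ⟨Finset.prod_nonneg fun s _ => (hI s i x).1,
      Finset.prod_le_one (fun s _ => (hI s i x).1) fun s _ => (hI s i x).2⟩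
  · rw [ContinuousMap.prod_apply]
    exact Finset.prod_eq_one fun s _ => h1 s i x hx
  · by_contra hne
    obtain ⟨i, hi, hi0⟩ := h0 s (Set.not_nonempty_iff_eq_empty.1 hne) x
    refine hs i hi ?_
    rw [ContinuousMap.prod_apply]
    exact Finset.prod_eq_zero (Finset.mem_univ s) hi0

/-- If the nerve of a finite closed cover of a normal space maps to that of a family of convex
sets, then there is a continuous map carrying each set of the cover to the corresponding convex
set. -/
theorem exists_continuousMap_mapsTo_convex {X : Type*} [TopologicalSpace X] [NormalSpace X]
    {E : Type*} [AddCommGroup E] [Module ℝ E] [TopologicalSpace E] [IsTopologicalAddGroup E]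
    [ContinuousSMul ℝ E] {ι : Type*} [Finite ι] {F : ι → Set X} {C : ι → Set E}
    (hF : ∀ i, IsClosed (F i)) (hcover : ∀ x, ∃ i, x ∈ F i) (hconv : ∀ i, Convex ℝ (C i))
    (hnerve : ∀ s : Finset ι, s.Nonempty → (⋂ i ∈ s, F i).Nonempty → (⋂ i ∈ s, C i).Nonempty) :
    ∃ r : C(X, ↥(⋃ j, C j)), ∀ i, ∀ x ∈ F i, (r x : E) ∈ C i := by
  classical
  have := Fintype.ofFinite ι
  obtain ⟨l, hI, h1, hl⟩ := exists_continuous_one_on_of_nerve hF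
  have hc : ∀ s : Finset ι, ∃ c : E, (⋂ i ∈ s, C i).Nonempty → c ∈ ⋂ i ∈ s, C i := by
    intro s
    by_cases hs : (⋂ i ∈ s, C i).Nonempty
    · exact ⟨hs.some, fun _ => hs.some_mem⟩
    · exact ⟨0, fun h => absurd h hs⟩
  choose c hc using hc
  -- These are the terms of the expansion of $\prod_i(l_i+(1-l_i))=1$.
  let w : Finset ι → X → ℝ := fun s x => (∏ i ∈ s, l i x) * ∏ i ∈ sᶜ, (1 - l i x)
  have hw0 : ∀ s x, 0 ≤ w s x := fun s x =>
    mul_nonneg (Finset.prod_nonneg fun i _ => (hI i x).1)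
      (Finset.prod_nonneg fun i _ => sub_nonneg.2 (hI i x).2)
  have hw1 : ∀ x, ∑ s, w s x = 1 := by
    intro x
    have h := Finset.prod_add (fun i => l i x) (fun i => 1 - l i x) Finset.univ
    simp only [add_sub_cancel, Finset.prod_const_one, Finset.powerset_univ] at h
    simpa [w, Finset.compl_eq_univ_sdiff] using h.symm
  have hr : ∀ i, ∀ x ∈ F i, ∑ s, w s x • c s ∈ C i := by
    intro i x hx
    rw [← finsum_eq_sum_of_fintype]
    refine (hconv i).finsum_mem (fun s => hw0 s x) ?_ fun s hs => ?_
    · rw [finsum_eq_sum_of_fintype, hw1]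
    · have his : i ∈ s := by
        by_contra his
        refine hs (mul_eq_zero_of_right _ (Finset.prod_eq_zero (Finset.mem_compl.2 his) ?_))
        rw [h1 i x hx, sub_self]
      have hs' : (⋂ j ∈ s, F j).Nonempty := hl x s fun j hj h0 =>
        hs (mul_eq_zero_of_left (Finset.prod_eq_zero hj h0) _)
      exact Set.mem_iInter₂.1 (hc s (hnerve s ⟨i, his⟩ hs')) i his
  refine ⟨⟨fun x => ⟨∑ s, w s x • c s, ?_⟩, ?_⟩, hr⟩
  · obtain ⟨i, hi⟩ := hcover x
    exact Set.mem_iUnion.2 ⟨i, hr i x hi⟩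
  · refine Continuous.subtype_mk ?_ _
    simp only [w]
    fun_prop

theorem mainTheorem6 (R : Type*) [Ring R]
    {E : Type*} [AddCommGroup E] [Module ℝ E] [TopologicalSpace E]
    [IsTopologicalAddGroup E] [ContinuousSMul ℝ E]
    {E' : Type*} [AddCommGroup E'] [Module ℝ E'] [TopologicalSpace E']
    [IsTopologicalAddGroup E'] [ContinuousSMul ℝ E']
    (n : ℕ) (C : Fin n → Set E) (C' : Fin n → Set E')
    (hconv : ∀ i, Convex ℝ (C i)) (hconv' : ∀ i, Convex ℝ (C' i))
    (hclosed : ∀ i, IsClosed {x : ↥(⋃ j, C j) | (x : E) ∈ C i})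
    (hclosed' : ∀ i, IsClosed {x : ↥(⋃ j, C' j) | (x : E') ∈ C' i})
    (hnormal : NormalSpace ↥(⋃ j, C j)) (hnormal' : NormalSpace ↥(⋃ j, C' j))
    (hnerve : NervesNaturallyIsomorphic C C')
    (q : C(↥(⋃ j, C j), ↥(⋃ j, C' j)))
    (hq : ∀ i, ∀ x : ↥(⋃ j, C j), (x : E) ∈ C i → (q x : E') ∈ C' i) :
    ∀ p : ℕ, Function.Bijective (AlexanderSpanier.pullback R q p) := by
  obtain ⟨r, hr⟩ := exists_continuousMap_mapsTo_convex hclosed'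
    (fun x => (Set.mem_iUnion.1 x.2 : ∃ i, (x : E') ∈ C' i)) hconv fun s hs ⟨y, hy⟩ =>
      (hnerve s hs).2 ⟨y, Set.mem_iInter₂.2 fun i hi => Set.mem_iInter₂.1 hy i hi⟩
  exact AlexanderSpanier.pullback_bijective_of_homotopyInverse R
    (homotopic_id_of_mapsTo_convex hconv (r.comp q) fun i x hx => hr i _ (hq i x hx))
    (homotopic_id_of_mapsTo_convex hconv' (q.comp r) fun i x hx => hq i _ (hr i x hx))
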